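/- Let $n \geq 3$. For $i \in \mathbb{Z}/n\mathbb{Z}$ let $s_i$ be the permutation of $\mathbb{Z}$ with $s_i(t) = t+1$ if $t \equiv i \pmod n$, $s_i(t) = t-1$ if $t \equiv i+1 \pmod n$, and $s_i(t) = t$ otherwise; let $\rho$ be the permutation $t \mapsto t+1$ of $\mathbb{Z}$. Let $W = W(\widetilde{A}_{n-1})$ be the group generated by the $s_i$ (the affine Weyl group of type $\widetilde{A}_{n-1}$, with Coxeter generators $s_i$), and let $\widehat{W} = \langle W, \rho\rangle$ be the extended affine Weyl group associated to $GL_n(\mathbb{C})$. Permutations are composed as left actions on $\mathbb{Z}$. Every $w \in \widehat{W}$ can be written uniquely as $w = \rho^z u$ with $z \in \mathbb{Z}$ and $u \in W$. An element $u \in W$ is called fully commutative if no reduced expression (word of minimal length in the $s_i$ representing $u$) contains a subword of consecutive letters of the form $s_i s_j s_i$; it is called $321$-avoiding if there are no integers $a<b<c$ with $u(a)>u(b)>u(c)$. An element $w = \rho^z u \in \widehat{W}$ is called fully commutative (respectively $321$-avoiding) if $u$ is. Let $\widehat{W}$ act linearly on the free abelian group with basis the simple roots $\alpha_i$, $i \in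 \mathbb{Z}/n\mathbb{Z}$, by $\rho(\alpha_i) = \alpha_{i+1}$, $s_i(\alpha_i) = -\alpha_i$, $s_i(\alpha_j) = \alpha_j + \alpha_i$ if $j = i \pm 1$, and $s_i(\alpha_j) = \alpha_j$ otherwise. The roots are the vectors $u(\alpha_i)$ with $u \in W$; a root is positive (written $>0$), respectively negative (written $<0$), if all of its coefficients with respect to the $\alpha_i$ are $\geq 0$, respectively $\leq 0$. Proposition 4.3. Let $w \in \widehat{W}$. The following are equivalent: (i) $w$ is fully commutative; (ii) $w$ is $321$-avoiding; (iii) there are no positive roots $\alpha$, $\beta$, $\alpha+\beta$ such that $w(\alpha) < 0$ and $w(\beta) < 0$. -/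

import Mathlib

/-!
The affine Weyl group of type `A` with cyclic Dynkin diagram on `n ≥ 3` nodes, and its extension
attached to `GL_n(ℂ)`, both realized as groups of permutations of `ℤ` acting on the left, and the
action of the extended group on the root system.  The nodes of the diagram are indexed by `ZMod n`.
-/

namespace AffineA

/-- The map `ℤ → ℤ` underlying the Coxeter generator `s_i`: it sends `t` to `t + 1` if `t ≡ i`,
to `t - 1` if `t ≡ i + 1`, and to `t` otherwise (congruences modulo `n`). -/
def simpleFun (n : ℕ) (i : ZMod n) (t : ℤ) : ℤ :=
  if (t : ZMod n) = i then t + 1 else if (t : ZMod n) = i + 1 then t - 1 else t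

theorem one_ne_zero' (n : ℕ) [hn : Fact (3 ≤ n)] : (1 : ZMod n) ≠ 0 := by
  have : Fact (1 < n) := ⟨by have := hn.out; omega⟩
  exact one_ne_zero

theorem two_ne_zero' (n : ℕ) [hn : Fact (3 ≤ n)] : (1 + 1 : ZMod n) ≠ 0 := by
  have h : ((2 : ℕ) : ZMod n) ≠ 0 := by
    rw [Ne, ZMod.natCast_eq_zero_iff]
    intro h
    have := Nat.le_of_dvd (by norm_num) h
    have := hn.out
    omega
  intro h'
  apply h
  push_cast
  rw [← h']
  norm_num

theorem simpleFun_involutive (n : ℕ) [hn : Fact (3 ≤ n)] (i : ZMod n) :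
    Function.Involutive (simpleFun n i) := by
  intro t
  have h1 := one_ne_zero' n
  unfold simpleFun
  by_cases h : (t : ZMod n) = i
  · simp [h, h1]
  · by_cases h' : (t : ZMod n) = i + 1
    · simp [h', h1]
    · simp [h, h']

/-- The Coxeter generator `s_i` as a permutation of `ℤ`. -/
def simpleRefl (n : ℕ) [hn : Fact (3 ≤ n)] (i : ZMod n) : Equiv.Perm ℤ :=
  (simpleFun_involutive n i).toPerm

/-- The shift `ρ : t ↦ t + 1`. -/
def rho : Equiv.Perm ℤ := Equiv.addRight (1 : ℤ)

/-- The affine Weyl group `W`: the group of permutations generated by the `s_i`. -/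
def affineWeyl (n : ℕ) [hn : Fact (3 ≤ n)] : Subgroup (Equiv.Perm ℤ) :=
  Subgroup.closure (Set.range (simpleRefl n))

/-- The extended affine Weyl group: the group of permutations generated by `W` and `ρ`. -/
def extAffineWeyl (n : ℕ) [hn : Fact (3 ≤ n)] : Subgroup (Equiv.Perm ℤ) :=
  Subgroup.closure ((affineWeyl n : Set (Equiv.Perm ℤ)) ∪ {rho})

/-- The element of the group that a word in the generators represents. -/
def wordProd (n : ℕ) [hn : Fact (3 ≤ n)] (l : List (ZMod n)) : Equiv.Perm ℤ :=
  (l.map (simpleRefl n)).prod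

/-- `l` is a reduced expression for `u`: a word of minimal length that represents `u`. -/
def IsReducedExpr (n : ℕ) [hn : Fact (3 ≤ n)] (l : List (ZMod n)) (u : Equiv.Perm ℤ) : Prop :=
  wordProd n l = u ∧ ∀ l' : List (ZMod n), wordProd n l' = u → l.length ≤ l'.length

/-- `u ∈ W` is fully commutative if no reduced expression for `u` contains a (contiguous) subword
`s_i s_j s_i`.  (If `s_i` and `s_j` commute, no reduced expression can contain that subword.) -/
def IsFullyComm (n : ℕ) [hn : Fact (3 ≤ n)] (u : affineWeyl n) : Prop :=
  ∀ l : List (ZMod n), IsReducedExpr n l u → ∀ i j : ZMod n, ¬ [i, j, i] <:+: l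

/-- `u ∈ W` is 321-avoiding if there are no `a < b < c` with `u a > u b > u c`. -/
def Is321Avoiding (n : ℕ) [hn : Fact (3 ≤ n)] (u : affineWeyl n) : Prop :=
  ¬ ∃ a b c : ℤ, a < b ∧ b < c ∧
    (u : Equiv.Perm ℤ) b < (u : Equiv.Perm ℤ) a ∧ (u : Equiv.Perm ℤ) c < (u : Equiv.Perm ℤ) b

/-- An element `w = ρ ^ z * u` of the extended group, with `z ∈ ℤ` and `u ∈ W`, is fully
commutative if `u` is. -/
def ExtIsFullyComm (n : ℕ) [hn : Fact (3 ≤ n)] (w : extAffineWeyl n) : Prop :=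
  ∃ (z : ℤ) (u : affineWeyl n), (w : Equiv.Perm ℤ) = rho ^ z * u ∧ IsFullyComm n u

/-- An element `w = ρ ^ z * u` of the extended group, with `z ∈ ℤ` and `u ∈ W`, is 321-avoiding
if `u` is. -/
def ExtIs321Avoiding (n : ℕ) [hn : Fact (3 ≤ n)] (w : extAffineWeyl n) : Prop :=
  ∃ (z : ℤ) (u : affineWeyl n), (w : Equiv.Perm ℤ) = rho ^ z * u ∧ Is321Avoiding n u

theorem simpleRefl_apply (n : ℕ) [hn : Fact (3 ≤ n)] (i : ZMod n) (t : ℤ) :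
    simpleRefl n i t =
      if (t : ZMod n) = i then t + 1 else if (t : ZMod n) = i + 1 then t - 1 else t := rfl

theorem rho_apply (t : ℤ) : rho t = t + 1 := rfl

theorem simpleRefl_mem (n : ℕ) [hn : Fact (3 ≤ n)] (i : ZMod n) :
    simpleRefl n i ∈ extAffineWeyl n :=
  Subgroup.subset_closure (Or.inl (Subgroup.subset_closure ⟨i, rfl⟩))

theorem rho_mem (n : ℕ) [hn : Fact (3 ≤ n)] : rho ∈ extAffineWeyl n :=
  Subgroup.subset_closure (Or.inr rfl)

theorem extAffineWeyl_induction (n : ℕ) [hn : Fact (3 ≤ n)] (H : Subgroup (Equiv.Perm ℤ))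
    (hs : ∀ i, simpleRefl n i ∈ H) (hr : rho ∈ H) : extAffineWeyl n ≤ H := by
  refine (Subgroup.closure_le H).2 (Set.union_subset ?_ (Set.singleton_subset_iff.2 hr))
  refine (Subgroup.closure_le H).2 ?_
  rintro _ ⟨i, rfl⟩
  exact hs i

/-- Every element of the extended group commutes with translation by `n`. -/
theorem apply_add_n (n : ℕ) [hn : Fact (3 ≤ n)] (w : extAffineWeyl n) (t : ℤ) :
    (w : Equiv.Perm ℤ) (t + n) = (w : Equiv.Perm ℤ) t + n := by
  have key := extAffineWeyl_induction n (Subgroup.centralizer {Equiv.addRight (n : ℤ)}) (by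
    intro i
    rw [Subgroup.mem_centralizer_singleton_iff]
    ext x
    simp only [Equiv.Perm.mul_apply, Equiv.coe_addRight, simpleRefl_apply, Int.cast_add,
      Int.cast_natCast, CharP.cast_eq_zero, add_zero]
    split_ifs <;> ring) (by
    rw [Subgroup.mem_centralizer_singleton_iff]
    ext x
    simp only [Equiv.Perm.mul_apply, Equiv.coe_addRight, rho_apply]
    ring) w.2
  rw [Subgroup.mem_centralizer_singleton_iff] at key
  exact congrArg (fun f : Equiv.Perm ℤ => f t) key

/-- The root lattice: integer combinations of the simple roots `α_i`, `i ∈ ZMod n`. -/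
abbrev RootLattice (n : ℕ) : Type := ZMod n →₀ ℤ

/-- The simple root `α_i`. -/
noncomputable def simpleRoot (n : ℕ) (i : ZMod n) : RootLattice n := Finsupp.single i 1

/-- The vector `α_a + α_{a+1} + ⋯ + α_{b-1}` if `a ≤ b`, and
`-(α_b + α_{b+1} + ⋯ + α_{a-1})` if `b ≤ a` (indices modulo `n`). -/
noncomputable def intervalRoot (n : ℕ) (a b : ℤ) : RootLattice n :=
  ∑ t ∈ Finset.Ico a b, simpleRoot n t - ∑ t ∈ Finset.Ico b a, simpleRoot n t

theorem intervalRoot_succ_self (n : ℕ) (a : ℤ) : intervalRoot n a (a + 1) = simpleRoot n a := by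
  have h : Finset.Ico a (a + 1) = {a} := by ext x; simp; omega
  simp [intervalRoot, h]

theorem intervalRoot_swap (n : ℕ) (a b : ℤ) : intervalRoot n b a = -intervalRoot n a b := by
  simp [intervalRoot]

theorem intervalRoot_succ (n : ℕ) (a b : ℤ) :
    intervalRoot n a (b + 1) = intervalRoot n a b + simpleRoot n b := by
  unfold intervalRoot
  rcases le_or_gt a b with h | h
  · have h1 : Finset.Ico a (b + 1) = insert b (Finset.Ico a b) := by ext x; simp; omega
    have h2 : Finset.Ico b a = ∅ := by simp [h]
    have h3 : Finset.Ico (b + 1) a = ∅ := by simp; omega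
    rw [h1, h2, h3, Finset.sum_insert (by simp)]
    simp [add_comm]
  · have h1 : Finset.Ico b a = insert b (Finset.Ico (b + 1) a) := by ext x; simp; omega
    have h2 : Finset.Ico a b = ∅ := by simp; omega
    have h3 : Finset.Ico a (b + 1) = ∅ := by simp; omega
    rw [h1, h2, h3, Finset.sum_insert (by simp)]
    simp

theorem intervalRoot_add (n : ℕ) (a b c : ℤ) :
    intervalRoot n a b + intervalRoot n b c = intervalRoot n a c := by
  induction c using Int.inductionOn' (b := b) with
  | zero => simp [intervalRoot]
  | succ k _ ih => rw [intervalRoot_succ, intervalRoot_succ, ← ih, add_assoc]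
  | pred k _ ih =>
    have h1 := intervalRoot_succ n b (k - 1)
    have h2 := intervalRoot_succ n a (k - 1)
    rw [sub_add_cancel] at h1 h2
    rw [h1, h2, ← add_assoc] at ih
    exact add_right_cancel ih

theorem intervalRoot_add_n (n : ℕ) (a b : ℤ) :
    intervalRoot n (a + n) (b + n) = intervalRoot n a b := by
  induction b using Int.inductionOn' (b := a) with
  | zero => simp [intervalRoot]
  | succ k _ ih =>
    rw [show k + 1 + (n : ℤ) = k + n + 1 by ring, intervalRoot_succ, intervalRoot_succ, ih]
    simp
  | pred k _ ih =>
    have h1 := intervalRoot_succ n (a + n) (k - 1 + n)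
    have h2 := intervalRoot_succ n a (k - 1)
    rw [sub_add_cancel] at h2
    rw [show k - 1 + (n : ℤ) + 1 = k + n by ring] at h1
    rw [h1, h2] at ih
    simpa using ih

/-- The linear map by which `w` acts on the root lattice.  It sends `α_t` (for `t ∈ ℤ`, index
modulo `n`) to `intervalRoot n (w t) (w (t + 1))`; here `t` is a chosen representative. -/
noncomputable def rootMap (n : ℕ) [hn : Fact (3 ≤ n)] (w : extAffineWeyl n) :
    RootLattice n →ₗ[ℤ] RootLattice n :=
  Finsupp.linearCombination ℤ fun i : ZMod n =>
    intervalRoot n ((w : Equiv.Perm ℤ) (i.cast : ℤ)) ((w : Equiv.Perm ℤ) ((i.cast : ℤ) + 1))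

theorem intervalRoot_apply_add_mul (n : ℕ) [hn : Fact (3 ≤ n)] (w : extAffineWeyl n) (t k : ℤ) :
    intervalRoot n ((w : Equiv.Perm ℤ) (t + n * k)) ((w : Equiv.Perm ℤ) (t + n * k + 1)) =
      intervalRoot n ((w : Equiv.Perm ℤ) t) ((w : Equiv.Perm ℤ) (t + 1)) := by
  have step : ∀ m : ℤ,
      intervalRoot n ((w : Equiv.Perm ℤ) (m + n)) ((w : Equiv.Perm ℤ) (m + n + 1)) =
        intervalRoot n ((w : Equiv.Perm ℤ) m) ((w : Equiv.Perm ℤ) (m + 1)) := by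
    intro m
    rw [show m + (n : ℤ) + 1 = m + 1 + n by ring, apply_add_n, apply_add_n, intervalRoot_add_n]
  induction k using Int.induction_on with
  | zero => simp
  | succ k ih =>
    rw [← ih, ← step (t + n * k), show t + (n : ℤ) * (k + 1) = t + n * k + n by ring]
  | pred k ih =>
    rw [← ih, ← step (t + n * (-k - 1)),
      show t + (n : ℤ) * (-k - 1) + n = t + n * -k by ring]

/-- The image of a simple root does not depend on the representative. -/
theorem rootMap_simpleRoot (n : ℕ) [hn : Fact (3 ≤ n)] (w : extAffineWeyl n) (t : ℤ) :
    rootMap n w (simpleRoot n t) =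
      intervalRoot n ((w : Equiv.Perm ℤ) t) ((w : Equiv.Perm ℤ) (t + 1)) := by
  have h : (((t : ZMod n).cast : ℤ) : ZMod n) = ((t : ℤ) : ZMod n) := ZMod.intCast_zmod_cast _
  rw [ZMod.intCast_eq_intCast_iff_dvd_sub] at h
  obtain ⟨k, hk⟩ := h
  have ht : t = ((t : ZMod n).cast : ℤ) + n * k := by linarith
  have := intervalRoot_apply_add_mul n w ((t : ZMod n).cast : ℤ) k
  rw [← ht] at this
  rw [this]
  simp [rootMap, simpleRoot]

theorem rootMap_intervalRoot (n : ℕ) [hn : Fact (3 ≤ n)] (w : extAffineWeyl n) (a b : ℤ) :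
    rootMap n w (intervalRoot n a b) =
      intervalRoot n ((w : Equiv.Perm ℤ) a) ((w : Equiv.Perm ℤ) b) := by
  induction b using Int.inductionOn' (b := a) with
  | zero => simp [intervalRoot]
  | succ k _ ih =>
    rw [intervalRoot_succ, map_add, ih, rootMap_simpleRoot, intervalRoot_add]
  | pred k _ ih =>
    have h1 := intervalRoot_succ n a (k - 1)
    rw [sub_add_cancel] at h1
    rw [h1, map_add, rootMap_simpleRoot, sub_add_cancel,
      ← intervalRoot_add n ((w : Equiv.Perm ℤ) a) ((w : Equiv.Perm ℤ) (k - 1))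
        ((w : Equiv.Perm ℤ) k)] at ih
    exact add_right_cancel ih

theorem rootLattice_hom_ext (n : ℕ) {f g : RootLattice n →ₗ[ℤ] RootLattice n}
    (h : ∀ t : ℤ, f (simpleRoot n t) = g (simpleRoot n t)) : f = g := by
  refine Finsupp.lhom_ext' fun i => LinearMap.ext_ring ?_
  have h' := h (i.cast : ℤ)
  rw [ZMod.intCast_zmod_cast] at h'
  simpa [simpleRoot] using h'

/-- The linear action of the extended affine Weyl group on the root lattice.  It is the unique
action in which `s_i` and `ρ` act by the usual formulas, see `rootAction_simpleRefl`,
`rootAction_rho` and `rootAction_unique` below. -/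
noncomputable def rootAction (n : ℕ) [hn : Fact (3 ≤ n)] :
    extAffineWeyl n →* Module.End ℤ (RootLattice n) where
  toFun w := rootMap n w
  map_one' := rootLattice_hom_ext n fun t => by
    rw [rootMap_simpleRoot]
    exact intervalRoot_succ_self n t
  map_mul' v w := rootLattice_hom_ext n fun t => by
    rw [Module.End.mul_apply, rootMap_simpleRoot, rootMap_simpleRoot, rootMap_intervalRoot]
    rfl

/-- `s_i α_i = -α_i`, `s_i α_j = α_j + α_i` if `i` and `j` are adjacent, `s_i α_j = α_j` else. -/
theorem rootAction_simpleRefl (n : ℕ) [hn : Fact (3 ≤ n)] (i j : ZMod n) :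
    rootAction n ⟨simpleRefl n i, simpleRefl_mem n i⟩ (simpleRoot n j) =
      if i = j then -simpleRoot n j
      else if i = j - 1 ∨ i = j + 1 then simpleRoot n j + simpleRoot n i
      else simpleRoot n j := by
  obtain ⟨t, rfl⟩ := ZMod.intCast_surjective j
  have h1 := one_ne_zero' n
  have h2 := two_ne_zero' n
  change rootMap n _ _ = _
  rw [rootMap_simpleRoot]
  simp only [simpleRefl_apply, Int.cast_add, Int.cast_one]
  by_cases e1 : i = t
  · subst e1
    simp only [if_true, add_eq_left, h1, if_false]
    rw [intervalRoot_swap, add_sub_cancel_right, intervalRoot_succ_self]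
  · rw [if_neg (Ne.symm e1), if_neg e1]
    by_cases e2 : i = t - 1
    · subst e2
      have h3 : ((t : ZMod n) + 1) ≠ t - 1 := by
        intro h
        apply h2
        linear_combination h
      rw [if_pos (by ring), if_neg h3, if_neg (by simpa using h1), if_pos (Or.inl rfl),
        intervalRoot_succ, ← intervalRoot_succ_self n t]
      have h4 := intervalRoot_succ_self n (t - 1)
      rw [sub_add_cancel] at h4
      rw [h4, intervalRoot_succ_self, add_comm]
      simp
    · have h3 : ¬ ((t : ZMod n) = i + 1) := fun h => e2 (by rw [h]; ring)
      rw [if_neg h3]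
      by_cases e3 : i = t + 1
      · rw [if_pos e3.symm, if_pos (Or.inr e3), intervalRoot_succ, intervalRoot_succ_self, e3]
        simp
      · have h4 : ¬ ((t : ZMod n) + 1 = i + 1) := fun h => e1 (add_right_cancel h).symm
        rw [if_neg (Ne.symm e3), if_neg h4, if_neg (by tauto), intervalRoot_succ_self]

/-- `ρ α_i = α_{i+1}`. -/
theorem rootAction_rho (n : ℕ) [hn : Fact (3 ≤ n)] (i : ZMod n) :
    rootAction n ⟨rho, rho_mem n⟩ (simpleRoot n i) = simpleRoot n (i + 1) := by
  obtain ⟨t, rfl⟩ := ZMod.intCast_surjective i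
  change rootMap n _ _ = _
  rw [rootMap_simpleRoot]
  simp only [rho_apply]
  rw [intervalRoot_succ_self]
  simp

/-- The formulas for `s_i` and `ρ` determine the action. -/
theorem rootAction_unique (n : ℕ) [hn : Fact (3 ≤ n)]
    (A : extAffineWeyl n →* Module.End ℤ (RootLattice n))
    (hs : ∀ i j : ZMod n, A ⟨simpleRefl n i, simpleRefl_mem n i⟩ (simpleRoot n j) =
      if i = j then -simpleRoot n j
      else if i = j - 1 ∨ i = j + 1 then simpleRoot n j + simpleRoot n i
      else simpleRoot n j)
    (hr : ∀ i : ZMod n, A ⟨rho, rho_mem n⟩ (simpleRoot n i) = simpleRoot n (i + 1)) :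
    A = rootAction n := by
  have key : extAffineWeyl n ≤ (A.eqLocus (rootAction n)).map (extAffineWeyl n).subtype := by
    refine extAffineWeyl_induction n _ (fun i => ⟨⟨_, simpleRefl_mem n i⟩, ?_, rfl⟩)
      ⟨⟨_, rho_mem n⟩, ?_, rfl⟩
    · exact rootLattice_hom_ext n fun t => by rw [hs, rootAction_simpleRefl]
    · exact rootLattice_hom_ext n fun t => by rw [hr, rootAction_rho]
  ext1 w
  obtain ⟨v, hv, hvw⟩ := key w.2
  have : v = w := Subtype.ext hvw
  exact this ▸ hv

/-- The (real) roots: the images of the simple roots under `W`. -/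
def IsRoot (n : ℕ) [hn : Fact (3 ≤ n)] (v : RootLattice n) : Prop :=
  ∃ (u : extAffineWeyl n) (i : ZMod n),
    (u : Equiv.Perm ℤ) ∈ affineWeyl n ∧ v = rootAction n u (simpleRoot n i)

/-- A root is positive if all its coefficients on the simple roots are nonnegative. -/
def IsPosRoot (n : ℕ) [hn : Fact (3 ≤ n)] (v : RootLattice n) : Prop :=
  IsRoot n v ∧ ∀ i, 0 ≤ v i

/-- A root is negative if all its coefficients on the simple roots are nonpositive. -/
def IsNegRoot (n : ℕ) [hn : Fact (3 ≤ n)] (v : RootLattice n) : Prop :=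
  IsRoot n v ∧ ∀ i, v i ≤ 0

end AffineA

/-! Everything is read off from inversions of periodic permutations, those with u(t + n) = u(t) + n.

Roots and patterns. The roots are exactly the vectors `intervalRoot n a b` with a, b incongruent mod
n; such a root is positive iff a < b, and w sends it to the interval root from w(a) to w(b). So the
positive roots made negative are the inversions. A 321 pattern a < b < c gives the roots of (a, b),
(b, c) and their sum (a, c). Conversely, if two roots add up to a root, then an endpoint of one
continues the other mod n (`chain_of_add_eq`), and a translation by a multiple of n produces the
pattern.

Words and patterns. The tool is the exchange condition (`exchange`): a word for u with u(t + 1) <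
u(t) yields a word for u s_t with one letter fewer. In a reduced word x · s_i s_j s_i · y, it forces
x and the inverse of y to be increasing on the three consecutive integers reversed by the braid, so
the product has a 321 pattern. Conversely, a 321 pattern either occupies consecutive positions, and
then a braid splits off on the right, or survives the removal of some descent
(`exists_descent_of_pattern`); induction on word length concludes.

Left multiplication by a power of ρ shifts all values equally, so patterns in ρ^z u are those of u.
-/

namespace AffineA

variable {n : ℕ}

/-! ### Periodic permutations of ℤ -/

theorem apply_add_mul {u : Equiv.Perm ℤ} (hu : ∀ t, u (t + n) = u t + n) (t k : ℤ) :
    u (t + n * k) = u t + n * k := by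
  induction k using Int.induction_on with
  | zero => simp
  | succ k ih => rw [show t + (n : ℤ) * (k + 1) = t + n * k + n by ring, hu, ih]; ring
  | pred k ih =>
    have := hu (t + n * (-k - 1))
    rw [show t + (n : ℤ) * (-k - 1) + n = t + n * -k by ring, ih] at this
    linarith

theorem exists_eq_add_mul {x y : ℤ} (h : (x : ZMod n) = y) : ∃ k : ℤ, y = x + n * k := by
  rw [ZMod.intCast_eq_intCast_iff_dvd_sub] at h
  obtain ⟨k, hk⟩ := h
  exact ⟨k, by linarith⟩

theorem apply_sub_apply {u : Equiv.Perm ℤ} (hu : ∀ t, u (t + n) = u t + n) {x y : ℤ}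
    (h : (x : ZMod n) = y) : u y - u x = y - x := by
  obtain ⟨k, rfl⟩ := exists_eq_add_mul h
  rw [apply_add_mul hu]
  ring

theorem cast_apply_eq {u : Equiv.Perm ℤ} (hu : ∀ t, u (t + n) = u t + n) {x y : ℤ}
    (h : (x : ZMod n) = y) : ((u x : ℤ) : ZMod n) = (u y : ℤ) := by
  obtain ⟨k, rfl⟩ := exists_eq_add_mul h
  rw [apply_add_mul hu]
  simp

theorem periodic_inv {u : Equiv.Perm ℤ} (hu : ∀ t, u (t + n) = u t + n) (t : ℤ) :
    u⁻¹ (t + n) = u⁻¹ t + n := by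
  rw [Equiv.Perm.inv_eq_iff_eq, hu]
  simp

theorem cast_apply_ne {u : Equiv.Perm ℤ} (hu : ∀ t, u (t + n) = u t + n) {x y : ℤ}
    (h : (x : ZMod n) ≠ y) : ((u x : ℤ) : ZMod n) ≠ (u y : ℤ) := by
  intro h'
  have := cast_apply_eq (periodic_inv hu) h'
  simp only [Equiv.Perm.inv_def, Equiv.symm_apply_apply] at this
  exact h this

/-- Positions of an inversion of a periodic permutation are not congruent modulo the period. -/
theorem cast_ne_of_inversion {u : Equiv.Perm ℤ} (hu : ∀ t, u (t + n) = u t + n) {x y : ℤ}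
    (h : x < y) (h' : u y < u x) : (x : ZMod n) ≠ y := by
  intro e
  have := apply_sub_apply hu e
  omega

theorem rho_zpow_apply (z t : ℤ) : (rho ^ z) t = t + z := by
  simp [rho]

/-! ### Signs and endpoints of interval roots -/

theorem intervalRoot_nonneg {a b : ℤ} (h : a ≤ b) (i : ZMod n) : 0 ≤ intervalRoot n a b i := by
  rw [intervalRoot, Finset.Ico_eq_empty (a := b) (by omega), Finset.sum_empty, sub_zero,
    Finsupp.finsetSum_apply]
  refine Finset.sum_nonneg fun t _ => ?_
  rw [simpleRoot, Finsupp.single_apply]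
  split_ifs <;> norm_num

theorem intervalRoot_pos {a b : ℤ} (h : a < b) : 0 < intervalRoot n a b (a : ZMod n) := by
  rw [← intervalRoot_add n a (a + 1) b, intervalRoot_succ_self, Finsupp.add_apply, simpleRoot,
    Finsupp.single_eq_same]
  have := intervalRoot_nonneg (n := n) (a := a + 1) (b := b) (by omega) (a : ZMod n)
  omega

theorem le_of_intervalRoot_nonneg {a b : ℤ} (h : ∀ i, 0 ≤ intervalRoot n a b i) : a ≤ b := by
  by_contra! hc
  have h1 := intervalRoot_pos (n := n) hc
  have h2 := h b
  rw [intervalRoot_swap n b a, Finsupp.neg_apply] at h2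
  omega

/-- The map from the root lattice to `ℤⁿ` sending `α_i` to `e_i - e_{i+1}`. -/
noncomputable def endpointMap (n : ℕ) : RootLattice n →ₗ[ℤ] RootLattice n :=
  Finsupp.linearCombination ℤ fun i : ZMod n => simpleRoot n i - simpleRoot n (i + 1)

theorem endpointMap_intervalRoot (a b : ℤ) :
    endpointMap n (intervalRoot n a b) = simpleRoot n a - simpleRoot n b := by
  have hs : ∀ t : ℤ, endpointMap n (simpleRoot n t) =
      simpleRoot n t - simpleRoot n ((t + 1 : ℤ) : ZMod n) := by
    intro t
    rw [simpleRoot, endpointMap, Finsupp.linearCombination_single, one_smul]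
    push_cast
    rfl
  induction b using Int.inductionOn' (b := a) with
  | zero => simp [intervalRoot]
  | succ k _ ih => rw [intervalRoot_succ, map_add, ih, hs]; abel
  | pred k _ ih =>
    have h1 := intervalRoot_succ n a (k - 1)
    rw [sub_add_cancel] at h1
    rw [h1, map_add, hs, sub_add_cancel] at ih
    rw [eq_sub_of_add_eq ih]
    abel

/-- Under `endpointMap` the equation becomes e_a - e_b + e_c - e_d = e_e - e_f. If nothing cancels
on the left, the coefficients at a and at c are at least 1, and equal to 2 if a ≡ c; the right side
has coefficients at most 1 and is positive at no more than one index. -/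
theorem chain_of_add_eq {a b c d e f : ℤ} (hab : (a : ZMod n) ≠ b) (hcd : (c : ZMod n) ≠ d)
    (h : intervalRoot n a b + intervalRoot n c d = intervalRoot n e f) :
    (b : ZMod n) = c ∨ (d : ZMod n) = a := by
  by_contra! hc
  have h1 := congrArg (endpointMap n) h
  rw [map_add, endpointMap_intervalRoot, endpointMap_intervalRoot, endpointMap_intervalRoot] at h1
  have ha := DFunLike.congr_fun h1 (a : ZMod n)
  have hc' := DFunLike.congr_fun h1 (c : ZMod n)
  simp only [Finsupp.add_apply, Finsupp.sub_apply, simpleRoot, Finsupp.single_apply] at ha hc'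
  grind

variable [hn : Fact (3 ≤ n)]

/-! ### Coxeter generators as permutations -/

theorem affineWeyl_le : affineWeyl n ≤ extAffineWeyl n :=
  fun _ h => Subgroup.subset_closure (Or.inl h)

theorem affineWeyl_periodic {u : Equiv.Perm ℤ} (hu : u ∈ affineWeyl n) (t : ℤ) :
    u (t + n) = u t + n :=
  apply_add_n n ⟨u, affineWeyl_le hu⟩ t

theorem simpleRefl_mem_affineWeyl (i : ZMod n) : simpleRefl n i ∈ affineWeyl n :=
  Subgroup.subset_closure ⟨i, rfl⟩

theorem simpleRefl_mul_self (i : ZMod n) : simpleRefl n i * simpleRefl n i = 1 :=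
  Equiv.ext (simpleFun_involutive n i)

theorem simpleRefl_inv (i : ZMod n) : (simpleRefl n i)⁻¹ = simpleRefl n i :=
  inv_eq_of_mul_eq_one_right (simpleRefl_mul_self i)

theorem simpleRefl_simpleRefl (i : ZMod n) (t : ℤ) : simpleRefl n i (simpleRefl n i t) = t :=
  simpleFun_involutive n i t

theorem simpleRefl_cast_self (t : ℤ) : simpleRefl n (t : ZMod n) t = t + 1 := by
  simp [simpleRefl_apply]

theorem simpleRefl_cast_succ (t : ℤ) : simpleRefl n (t : ZMod n) (t + 1) = t := by
  simp [simpleRefl_apply, one_ne_zero' n]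

theorem simpleRefl_of_ne {i : ZMod n} {t : ℤ} (h : (t : ZMod n) ≠ i) (h' : (t : ZMod n) ≠ i + 1) :
    simpleRefl n i t = t := by
  simp [simpleRefl_apply, h, h']

/-- A Coxeter generator reverses only the order of the adjacent pairs that it exchanges. -/
theorem simpleRefl_lt {i : ZMod n} {x y : ℤ} (h : x < y) (h' : (x : ZMod n) = i → y ≠ x + 1) :
    simpleRefl n i x < simpleRefl n i y := by
  have h1 := one_ne_zero' n
  rw [simpleRefl_apply, simpleRefl_apply]
  split_ifs with a b c
  · omega
  · have h2 : y ≠ x + 1 := h' a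
    have h3 : y ≠ x + 1 + 1 := by
      rintro rfl
      push_cast at c
      rw [a] at c
      exact h1 (by simpa using c)
    omega
  · have := h' a
    omega
  · omega
  · omega
  · omega
  · omega
  · have : y ≠ x + 1 := by
      rintro rfl
      have e : ((x + 1 : ℤ) : ZMod n) = i + 1 := by assumption
      push_cast at e
      exact a (add_right_cancel e)
    omega
  · omega

/-- Conjugating by u the exchange of t and t + 1 (mod n) gives the exchange of their images, which
is again a generator because these images are consecutive. -/
theorem mul_simpleRefl_of_adjacent {u : Equiv.Perm ℤ} (hu : ∀ t, u (t + n) = u t + n) {t : ℤ}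
    (h : u (t + 1) = u t + 1) :
    simpleRefl n ((u t : ℤ) : ZMod n) * u = u * simpleRefl n (t : ZMod n) := by
  ext m
  simp only [Equiv.Perm.mul_apply]
  by_cases e1 : (t : ZMod n) = m
  · obtain ⟨k, rfl⟩ := exists_eq_add_mul e1
    have h1 : simpleRefl n (t : ZMod n) (t + n * k) = t + 1 + n * k := by
      simp [simpleRefl_apply]; ring
    rw [h1, apply_add_mul hu, apply_add_mul hu, h]
    simp [simpleRefl_apply]; ring
  · by_cases e2 : ((t + 1 : ℤ) : ZMod n) = m
    · obtain ⟨k, rfl⟩ := exists_eq_add_mul e2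
      have h1 : simpleRefl n (t : ZMod n) (t + 1 + n * k) = t + n * k := by
        simp [simpleRefl_apply, one_ne_zero' n]; ring
      rw [h1, apply_add_mul hu, apply_add_mul hu, h]
      simp [simpleRefl_apply, one_ne_zero' n]; ring
    · have h1 := cast_apply_ne hu e1
      have h2 := cast_apply_ne hu e2
      rw [h] at h2
      push_cast at e2 h2
      rw [simpleRefl_of_ne (Ne.symm h1) (Ne.symm h2), simpleRefl_of_ne (Ne.symm e1) (Ne.symm e2)]

/-! ### Words, exchange and reduced expressions -/

theorem wordProd_append (l l' : List (ZMod n)) :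
    wordProd n (l ++ l') = wordProd n l * wordProd n l' := by
  simp [wordProd]

theorem wordProd_cons (i : ZMod n) (l : List (ZMod n)) :
    wordProd n (i :: l) = simpleRefl n i * wordProd n l := by
  simp [wordProd]

theorem wordProd_singleton (i : ZMod n) : wordProd n [i] = simpleRefl n i := by
  simp [wordProd]

theorem wordProd_reverse (l : List (ZMod n)) : wordProd n l.reverse = (wordProd n l)⁻¹ := by
  induction l with
  | nil => simp [wordProd]
  | cons i l ih =>
    rw [List.reverse_cons, wordProd_append, ih, wordProd_singleton, wordProd_cons, mul_inv_rev,
      simpleRefl_inv]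

theorem wordProd_mem (l : List (ZMod n)) : wordProd n l ∈ affineWeyl n := by
  refine Subgroup.list_prod_mem _ fun x hx => ?_
  obtain ⟨i, -, rfl⟩ := List.mem_map.1 hx
  exact simpleRefl_mem_affineWeyl i

theorem exists_wordProd {u : Equiv.Perm ℤ} (hu : u ∈ affineWeyl n) :
    ∃ l : List (ZMod n), wordProd n l = u := by
  induction hu using Subgroup.closure_induction with
  | mem x hx => obtain ⟨i, rfl⟩ := hx; exact ⟨[i], wordProd_singleton i⟩
  | one => exact ⟨[], by simp [wordProd]⟩
  | mul x y _ _ hx hy =>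
    obtain ⟨l, rfl⟩ := hx
    obtain ⟨l', rfl⟩ := hy
    exact ⟨l ++ l', wordProd_append l l'⟩
  | inv x _ hx =>
    obtain ⟨l, rfl⟩ := hx
    exact ⟨l.reverse, wordProd_reverse l⟩

theorem exists_isReducedExpr {u : Equiv.Perm ℤ} (hu : u ∈ affineWeyl n) :
    ∃ l : List (ZMod n), IsReducedExpr n l u := by
  obtain ⟨l, hl, hmin⟩ := (measure (List.length (α := ZMod n))).wf.has_min
    {l | wordProd n l = u} (exists_wordProd hu)
  exact ⟨l, hl, fun l' hl' => not_lt.1 (hmin l' hl')⟩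

/-- The exchange condition: a word for `u` with a descent at `t` can be shortened to a word for
`u * s_t` by deleting a letter. -/
theorem exchange (t : ℤ) (l : List (ZMod n)) (h : wordProd n l (t + 1) < wordProd n l t) :
    ∃ l' : List (ZMod n), wordProd n l' = wordProd n l * simpleRefl n (t : ZMod n) ∧
      l'.length + 1 = l.length := by
  induction l with
  | nil => simp [wordProd] at h
  | cons i l ih =>
    by_cases h' : wordProd n l (t + 1) < wordProd n l t
    · obtain ⟨l', h1, h2⟩ := ih h'
      exact ⟨i :: l', by rw [wordProd_cons, wordProd_cons, h1, mul_assoc], by simp [h2]⟩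
    · have hlt : wordProd n l t < wordProd n l (t + 1) :=
        lt_of_le_of_ne (not_lt.1 h') fun e => by
          have := (wordProd n l).injective e
          omega
      rw [wordProd_cons, Equiv.Perm.mul_apply, Equiv.Perm.mul_apply] at h
      -- The letter i creates the descent, and s_i reverses only the adjacent pairs it exchanges.
      -- Hence i is the letter to delete: s_i times the product of `l` is that product times s_t.
      have hadj : ((wordProd n l t : ℤ) : ZMod n) = i ∧
          wordProd n l (t + 1) = wordProd n l t + 1 := by
        by_contra hc
        exact lt_asymm h (simpleRefl_lt hlt fun e1 e2 => hc ⟨e1, e2⟩)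
      obtain ⟨rfl, h2⟩ := hadj
      refine ⟨l, ?_, rfl⟩
      rw [wordProd_cons, mul_simpleRefl_of_adjacent (affineWeyl_periodic (wordProd_mem l)) h2,
        mul_assoc, simpleRefl_mul_self, mul_one]

/-- A word that is a reduced expression for its product. -/
def IsReducedWord (l : List (ZMod n)) : Prop := IsReducedExpr n l (wordProd n l)

theorem IsReducedWord.of_append {x y z : List (ZMod n)} (h : IsReducedWord (x ++ y ++ z)) :
    IsReducedWord y := by
  refine ⟨rfl, fun y' hy' => ?_⟩
  have := h.2 (x ++ y' ++ z) (by simp only [wordProd_append, hy'])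
  simp only [List.length_append] at this
  omega

theorem IsReducedWord.reverse {l : List (ZMod n)} (h : IsReducedWord l) :
    IsReducedWord l.reverse := by
  refine ⟨rfl, fun l' hl' => ?_⟩
  have := h.2 l'.reverse (by rw [wordProd_reverse, hl', wordProd_reverse, inv_inv])
  simpa using this

/-- At a descent, `exchange` would represent the same element by a word two letters shorter. -/
theorem IsReducedWord.lt_of_concat {l : List (ZMod n)} {t : ℤ}
    (h : IsReducedWord (l ++ [(t : ZMod n)])) : wordProd n l t < wordProd n l (t + 1) := by
  by_contra h'
  have hlt : wordProd n l (t + 1) < wordProd n l t :=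
    lt_of_le_of_ne (not_lt.1 h') fun e => by
      have := (wordProd n l).injective e
      omega
  obtain ⟨l', h1, h2⟩ := exchange t l hlt
  have := h.2 l' (by rw [h1, wordProd_append, wordProd_singleton])
  simp at this
  omega

/-- Appending a letter at a descent. -/
theorem IsReducedExpr.concat {l : List (ZMod n)} {u : Equiv.Perm ℤ} {t : ℤ}
    (h : IsReducedExpr n l (u * simpleRefl n (t : ZMod n))) (ht : u (t + 1) < u t) :
    IsReducedExpr n (l ++ [(t : ZMod n)]) u := by
  refine ⟨by rw [wordProd_append, wordProd_singleton, h.1, mul_assoc, simpleRefl_mul_self, mul_one],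
    fun l' hl' => ?_⟩
  subst hl'
  obtain ⟨l'', h1, h2⟩ := exchange t l' ht
  have := h.2 l'' h1
  simp
  omega

/-! ### Braids in reduced words -/

theorem simpleRefl_comm {i j : ZMod n} (h1 : i ≠ j) (h2 : i ≠ j + 1) (h3 : j ≠ i + 1) :
    simpleRefl n i * simpleRefl n j = simpleRefl n j * simpleRefl n i := by
  obtain ⟨t, rfl⟩ := ZMod.intCast_surjective i
  have e1 : simpleRefl n j t = t := simpleRefl_of_ne h1 h2
  have e2 : simpleRefl n j (t + 1) = t + 1 :=
    simpleRefl_of_ne (by push_cast; exact Ne.symm h3)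
      (by push_cast; exact fun e => h1 (add_right_cancel e))
  have := mul_simpleRefl_of_adjacent (n := n) (t := t)
    (affineWeyl_periodic (simpleRefl_mem_affineWeyl j)) (by rw [e1, e2])
  rwa [e1] at this

/-- The letters of a braid in a reduced word are adjacent. -/
theorem IsReducedWord.adjacent {i j : ZMod n} (h : IsReducedWord [i, j, i]) :
    j = i + 1 ∨ i = j + 1 := by
  by_contra! hc
  -- Equal or commuting letters collapse the word to the single letter j.
  have key : wordProd n [j] = wordProd n [i, j, i] := by
    rw [wordProd_cons i, wordProd_cons j [i], wordProd_singleton, wordProd_singleton]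
    by_cases e : i = j
    · subst e
      rw [simpleRefl_mul_self, mul_one]
    · rw [← mul_assoc, simpleRefl_comm e hc.2 hc.1, mul_assoc, simpleRefl_mul_self, mul_one]
  have := h.2 [j] key
  simp at this

/-- Here n ≥ 3 enters: t, t + 1, t + 2 are distinct mod n, so s_t and s_{t+1} act on these three
integers as the two adjacent transpositions. -/
theorem cast_ne_add_two (t : ℤ) : (t : ZMod n) ≠ (t : ZMod n) + 1 + 1 := by
  intro h
  apply two_ne_zero' n
  linear_combination -h

theorem simpleRefl_succ_self (t : ℤ) : simpleRefl n ((t : ZMod n) + 1) t = t :=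
  simpleRefl_of_ne (by simpa using one_ne_zero' n) (cast_ne_add_two t)

theorem simpleRefl_succ_succ (t : ℤ) : simpleRefl n ((t : ZMod n) + 1) (t + 1) = t + 1 + 1 := by
  have := simpleRefl_cast_self (n := n) (t + 1)
  rwa [Int.cast_add, Int.cast_one] at this

theorem simpleRefl_succ_add_two (t : ℤ) :
    simpleRefl n ((t : ZMod n) + 1) (t + 1 + 1) = t + 1 := by
  have := simpleRefl_cast_succ (n := n) (t + 1)
  rwa [Int.cast_add, Int.cast_one] at this

theorem simpleRefl_cast_add_two (t : ℤ) : simpleRefl n (t : ZMod n) (t + 1 + 1) = t + 1 + 1 := by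
  refine simpleRefl_of_ne ?_ ?_
  · push_cast; exact (cast_ne_add_two t).symm
  · push_cast; simpa using one_ne_zero' n

/-- The part of a reduced word before a braid preserves the order of the three positions that the
braid permutes. -/
theorem IsReducedWord.braid_right {x : List (ZMod n)} {i j : ZMod n}
    (h : IsReducedWord (x ++ [i, j, i])) {t : ℤ}
    (ht : (i = t ∧ j = t + 1) ∨ (i = t + 1 ∧ j = t)) :
    wordProd n x t < wordProd n x (t + 1) ∧ wordProd n x (t + 1) < wordProd n x (t + 1 + 1) := by
  have h1 : IsReducedWord (x ++ [i]) := by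
    have : IsReducedWord ([] ++ (x ++ [i]) ++ [j, i]) := by simpa using h
    exact this.of_append
  have h2 : IsReducedWord (x ++ [i, j] ++ [i]) := by simpa using h
  -- The first letter i compares one adjacent pair under x. The last letter i compares the same pair
  -- under x s_i s_j, and s_i s_j carries it to the other adjacent pair.
  rcases ht with ⟨rfl, rfl⟩ | ⟨rfl, rfl⟩
  · refine ⟨h1.lt_of_concat, ?_⟩
    have := h2.lt_of_concat
    rw [wordProd_append, wordProd_cons, wordProd_singleton] at this
    simpa only [Equiv.Perm.mul_apply, simpleRefl_succ_self, simpleRefl_succ_succ,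
      simpleRefl_cast_self, simpleRefl_cast_add_two] using this
  · have e : ((t : ZMod n) + 1) = ((t + 1 : ℤ) : ZMod n) := by push_cast; rfl
    rw [e] at h1
    refine ⟨?_, h1.lt_of_concat⟩
    rw [e] at h2
    have := h2.lt_of_concat
    rw [wordProd_append, wordProd_cons, wordProd_singleton, ← e] at this
    simpa only [Equiv.Perm.mul_apply, simpleRefl_succ_self, simpleRefl_succ_succ,
      simpleRefl_cast_succ, simpleRefl_cast_add_two, simpleRefl_succ_add_two] using this

theorem braid_apply {i j : ZMod n} {t : ℤ}
    (ht : (i = t ∧ j = t + 1) ∨ (i = t + 1 ∧ j = t)) :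
    wordProd n [i, j, i] t = t + 1 + 1 ∧ wordProd n [i, j, i] (t + 1) = t + 1 ∧
      wordProd n [i, j, i] (t + 1 + 1) = t := by
  rw [wordProd_cons, wordProd_cons, wordProd_singleton]
  rcases ht with ⟨rfl, rfl⟩ | ⟨rfl, rfl⟩ <;>
  simp only [Equiv.Perm.mul_apply, simpleRefl_succ_self, simpleRefl_succ_succ,
      simpleRefl_cast_succ, simpleRefl_cast_add_two, simpleRefl_succ_add_two,
      simpleRefl_cast_self, and_self]

/-- The braid reverses t < t + 1 < t + 2 while the product of x and the inverse of the product of y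
preserve their order. The preimages of the three integers under the product of y are thus the
positions of a 321 pattern. -/
theorem IsFullyComm.of_is321Avoiding {u : affineWeyl n} (hu : Is321Avoiding n u) :
    IsFullyComm n u := by
  rintro l hl i j ⟨x, y, rfl⟩
  obtain ⟨hlu, hmin⟩ := hl
  have hred : IsReducedWord (x ++ [i, j, i] ++ y) := ⟨rfl, by rwa [hlu]⟩
  have hadj := hred.of_append.adjacent
  obtain ⟨t, ht⟩ : ∃ t : ℤ, (i = t ∧ j = t + 1) ∨ (i = t + 1 ∧ j = t) := by
    rcases hadj with rfl | rfl
    · obtain ⟨t, rfl⟩ := ZMod.intCast_surjective i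
      exact ⟨t, Or.inl ⟨rfl, rfl⟩⟩
    · obtain ⟨t, rfl⟩ := ZMod.intCast_surjective j
      exact ⟨t, Or.inr ⟨rfl, rfl⟩⟩
  have hx : IsReducedWord (x ++ [i, j, i]) := by
    have : IsReducedWord ([] ++ (x ++ [i, j, i]) ++ y) := by simpa using hred
    exact this.of_append
  -- The braid is a palindrome, so reversing the word puts y, inverted, in front of it.
  have hy : IsReducedWord (y.reverse ++ [i, j, i]) := by
    have h1 : IsReducedWord (x ++ ([i, j, i] ++ y) ++ []) := by simpa using hred
    simpa using h1.of_append.reverse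
  have hx' := hx.braid_right ht
  have hy' := hy.braid_right ht
  rw [wordProd_reverse] at hy'
  obtain ⟨b1, b2, b3⟩ := braid_apply ht
  refine hu ⟨_, _, _, hy'.1, hy'.2, ?_, ?_⟩
  · rw [← hlu, wordProd_append, wordProd_append]
    simpa only [Equiv.Perm.mul_apply, Equiv.Perm.inv_def, Equiv.apply_symm_apply, b1, b2] using hx'.2
  · rw [← hlu, wordProd_append, wordProd_append]
    simpa only [Equiv.Perm.mul_apply, Equiv.Perm.inv_def, Equiv.apply_symm_apply, b2, b3] using hx'.1

/-! ### From a 321 pattern to a braid -/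

/-- A permutation with a 321 pattern that is not at consecutive positions has a descent whose
removal keeps a 321 pattern. -/
theorem exists_descent_of_pattern {u : Equiv.Perm ℤ} (hu : ∀ t, u (t + n) = u t + n) (d : ℕ) :
    ∀ a b c : ℤ, c - a ≤ d → a < b → b < c → u b < u a → u c < u b →
      (∃ t, u (t + 1) < u t ∧ u (t + 1 + 1) < u (t + 1)) ∨
      ∃ t : ℤ, u (t + 1) < u t ∧ ∃ a b c : ℤ, a < b ∧ b < c ∧
        (u * simpleRefl n (t : ZMod n)) b < (u * simpleRefl n (t : ZMod n)) a ∧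
        (u * simpleRefl n (t : ZMod n)) c < (u * simpleRefl n (t : ZMod n)) b := by
  induction d with
  | zero => intros; omega
  | succ d ih =>
    intro a b c hd hab hbc hba hcb
    have nab := cast_ne_of_inversion hu hab hba
    have nbc := cast_ne_of_inversion hu hbc hcb
    -- If s_t exchanges neither a, b nor b, c as adjacent positions, it keeps a, b, c in order and
    -- moves the pattern to their images.
    have reduce : ∀ t : ℤ, u (t + 1) < u t → ((a : ZMod n) = t → b ≠ a + 1) →
        ((b : ZMod n) = t → c ≠ b + 1) → ∃ t : ℤ, u (t + 1) < u t ∧ ∃ a b c : ℤ, a < b ∧ b < c ∧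
        (u * simpleRefl n (t : ZMod n)) b < (u * simpleRefl n (t : ZMod n)) a ∧
        (u * simpleRefl n (t : ZMod n)) c < (u * simpleRefl n (t : ZMod n)) b :=
      fun t h h1 h2 => ⟨t, h, _, _, _, simpleRefl_lt hab h1, simpleRefl_lt hbc h2, by
        simpa only [Equiv.Perm.mul_apply, simpleRefl_simpleRefl] using hba, by
        simpa only [Equiv.Perm.mul_apply, simpleRefl_simpleRefl] using hcb⟩
    -- Across a gap the pattern is shrunk by moving a up or c down by one. Where this fails, a
    -- descent sits at a or at c - 1, and incongruence of the pattern's positions rules out the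
    -- forbidden exchanges.
    by_cases hc : c = b + 1
    · by_cases hb : b = a + 1
      · subst hc hb
        exact Or.inl ⟨a, hba, hcb⟩
      · by_cases hm : u b < u (a + 1)
        · exact ih (a + 1) b c (by push_cast at hd; omega) (by omega) hbc hm hcb
        · have : u (a + 1) ≤ u b := not_lt.1 hm
          exact Or.inr (reduce a (by omega) (fun _ => hb) fun e => absurd e.symm nab)
    · by_cases hm : u (c - 1) < u b
      · exact ih a b (c - 1) (by push_cast at hd; omega) hab (by omega) hba hm
      · have : u b ≤ u (c - 1) := not_lt.1 hm
        refine Or.inr (reduce (c - 1) (by rw [sub_add_cancel]; omega) ?_ fun _ => hc)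
        rintro e rfl
        apply nbc
        push_cast at e ⊢
        rw [e]
        ring

/-- Descents are stripped from the right while a pattern survives. Each one shortens the word, and
the empty word has no inversion, so a pattern at consecutive positions must eventually occur. -/
theorem exists_braid_of_pattern (k : ℕ) : ∀ u ∈ affineWeyl n,
    (∃ l : List (ZMod n), wordProd n l = u ∧ l.length ≤ k) →
    (∃ a b c : ℤ, a < b ∧ b < c ∧ u b < u a ∧ u c < u b) →
    ∃ l : List (ZMod n), IsReducedExpr n l u ∧ ∃ i j, [i, j, i] <:+: l := by
  induction k with
  | zero =>
    rintro u hu ⟨l, rfl, hl⟩ ⟨a, b, c, hab, -, hba, -⟩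
    obtain rfl : l = [] := List.length_eq_zero_iff.1 (Nat.le_zero.1 hl)
    simp [wordProd] at hba
    omega
  | succ k ih =>
    rintro u hu ⟨l, rfl, hl⟩ ⟨a, b, c, hab, hbc, hba, hcb⟩
    rcases exists_descent_of_pattern (affineWeyl_periodic hu) (c - a).toNat a b c
      (Int.self_le_toNat _) hab hbc hba hcb with ⟨t, h1, h2⟩ | ⟨t, h1, h2⟩
    -- Start from a reduced expression of u s_t s_{t+1} s_t. As u(t) > u(t + 1) > u(t + 2),
    -- restoring the letters t, t + 1, t happens at a descent each time, so the word stays reduced.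
    · obtain ⟨v, hv⟩ := exists_isReducedExpr (
        mul_mem (mul_mem (mul_mem hu (simpleRefl_mem_affineWeyl (t : ZMod n)))
          (simpleRefl_mem_affineWeyl ((t + 1 : ℤ) : ZMod n)))
          (simpleRefl_mem_affineWeyl (t : ZMod n)))
      have r1 := hv.concat (by
        simpa only [Equiv.Perm.mul_apply, Int.cast_add, Int.cast_one, simpleRefl_succ_self,
          simpleRefl_succ_succ, simpleRefl_cast_self, simpleRefl_cast_add_two] using h2)
      have r2 := r1.concat (by
        simpa only [Equiv.Perm.mul_apply, simpleRefl_cast_succ, simpleRefl_cast_add_two]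
          using h2.trans h1)
      exact ⟨_, r2.concat h1, t, ((t + 1 : ℤ) : ZMod n), v, [], by simp⟩
    · obtain ⟨l', e, hl'⟩ := exchange t l h1
      obtain ⟨v, hv, i, j, hij⟩ := ih _ (mul_mem hu (simpleRefl_mem_affineWeyl (t : ZMod n)))
        ⟨l', e, by omega⟩ h2
      exact ⟨_, hv.concat h1, i, j, hij.trans (List.infix_append_left)⟩

theorem isFullyComm_iff (u : affineWeyl n) : IsFullyComm n u ↔ Is321Avoiding n u := by
  refine ⟨fun h hp => ?_, IsFullyComm.of_is321Avoiding⟩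
  obtain ⟨l, hl⟩ := exists_wordProd u.2
  obtain ⟨v, hv, i, j, hij⟩ := exists_braid_of_pattern l.length u u.2 ⟨l, hl, le_rfl⟩ hp
  exact h v hv i j hij

/-! ### The decomposition ρ^z u -/

theorem rho_mul_simpleRefl (i : ZMod n) : rho * simpleRefl n i * rho⁻¹ = simpleRefl n (i + 1) := by
  rw [mul_inv_eq_iff_eq_mul]
  ext t
  simp only [Equiv.Perm.mul_apply, simpleRefl_apply, rho_apply, Int.cast_add, Int.cast_one,
    add_left_inj]
  split_ifs <;> ring

/-- Conjugation by ρ permutes the generators cyclically. -/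
theorem rho_mem_normalizer : rho ∈ Subgroup.normalizer (affineWeyl n : Set (Equiv.Perm ℤ)) := by
  have hrange : MulAut.conj rho '' Set.range (simpleRefl n) = Set.range (simpleRefl n) := by
    ext x
    constructor
    · rintro ⟨_, ⟨i, rfl⟩, rfl⟩
      exact ⟨i + 1, (rho_mul_simpleRefl i).symm⟩
    · rintro ⟨i, rfl⟩
      exact ⟨_, ⟨i - 1, rfl⟩, (rho_mul_simpleRefl (i - 1)).trans (by rw [sub_add_cancel])⟩
  have hmap : (affineWeyl n).map (MulAut.conj rho).toMonoidHom = affineWeyl n := by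
    rw [affineWeyl, MonoidHom.map_closure]
    exact congrArg _ hrange
  rw [Subgroup.mem_normalizer_iff]
  intro h
  constructor
  · intro hh
    rw [← hmap]
    exact ⟨h, hh, rfl⟩
  · intro hh
    rw [← hmap] at hh
    obtain ⟨g, hg, e⟩ := hh
    rwa [← show g = h from (MulAut.conj rho).injective e]

theorem exists_eq_rho_zpow_mul {w : Equiv.Perm ℤ} (hw : w ∈ extAffineWeyl n) :
    ∃ (z : ℤ) (u : affineWeyl n), w = rho ^ z * u := by
  have hle : Subgroup.zpowers rho ≤ Subgroup.normalizer (affineWeyl n : Set (Equiv.Perm ℤ)) :=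
    (Subgroup.zpowers_le).2 rho_mem_normalizer
  have : w ∈ Subgroup.zpowers rho ⊔ affineWeyl n :=
    extAffineWeyl_induction n _ (fun i => Subgroup.mem_sup_right (simpleRefl_mem_affineWeyl i))
      (Subgroup.mem_sup_left (Subgroup.mem_zpowers rho)) hw
  rw [← SetLike.mem_coe, Subgroup.coe_mul_of_left_le_normalizer_right _ _ hle] at this
  obtain ⟨_, ⟨z, rfl⟩, u, hu, rfl⟩ := this
  exact ⟨z, ⟨u, hu⟩, rfl⟩

/-- ρ^z adds z to every value and preserves comparisons, so any decomposition of w serves and its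
uniqueness is not needed. -/
theorem extIs321Avoiding_iff (w : extAffineWeyl n) : ExtIs321Avoiding n w ↔
    ¬ ∃ a b c : ℤ, a < b ∧ b < c ∧
      (w : Equiv.Perm ℤ) b < (w : Equiv.Perm ℤ) a ∧
      (w : Equiv.Perm ℤ) c < (w : Equiv.Perm ℤ) b := by
  constructor
  · rintro ⟨z, u, h, hu⟩
    rw [h]
    simpa only [Equiv.Perm.mul_apply, rho_zpow_apply, Is321Avoiding, add_lt_add_iff_right] using hu
  · intro hw
    obtain ⟨z, u, h⟩ := exists_eq_rho_zpow_mul w.2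
    refine ⟨z, u, h, ?_⟩
    rw [h] at hw
    simpa only [Equiv.Perm.mul_apply, rho_zpow_apply, Is321Avoiding, add_lt_add_iff_right] using hw

/-! ### Roots are the interval roots with incongruent endpoints -/

theorem isRoot_neg {v : RootLattice n} (h : IsRoot n v) : IsRoot n (-v) := by
  obtain ⟨u, i, hu, rfl⟩ := h
  refine ⟨u * ⟨simpleRefl n i, simpleRefl_mem n i⟩, i,
    mul_mem hu (simpleRefl_mem_affineWeyl i), ?_⟩
  rw [map_mul, Module.End.mul_apply, rootAction_simpleRefl, if_pos rfl, map_neg]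

theorem rootAction_intervalRoot (w : extAffineWeyl n) (a b : ℤ) :
    rootAction n w (intervalRoot n a b) =
      intervalRoot n ((w : Equiv.Perm ℤ) a) ((w : Equiv.Perm ℤ) b) :=
  rootMap_intervalRoot n w a b

theorem IsRoot.of_simpleRefl {a b : ℤ} (i : ZMod n)
    (h : IsRoot n (intervalRoot n (simpleRefl n i a) (simpleRefl n i b))) :
    IsRoot n (intervalRoot n a b) := by
  obtain ⟨u, j, hu, e⟩ := h
  refine ⟨⟨simpleRefl n i, simpleRefl_mem n i⟩ * u, j,
    mul_mem (simpleRefl_mem_affineWeyl i) hu, ?_⟩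
  rw [map_mul, Module.End.mul_apply, ← e, rootAction_intervalRoot]
  simp only [simpleRefl_simpleRefl]

/-- The reflection s_a moves the left end a to a + 1 and so shortens the interval, until a simple
root remains. -/
theorem isRoot_intervalRoot_of_lt (d : ℕ) : ∀ a b : ℤ, b - a ≤ d → a < b → (a : ZMod n) ≠ b →
    IsRoot n (intervalRoot n a b) := by
  induction d using Nat.strong_induction_on with
  | _ d ih =>
    intro a b hd hab hne
    by_cases h1 : b = a + 1
    · subst h1
      refine ⟨1, a, one_mem _, ?_⟩
      rw [intervalRoot_succ_self, map_one, Module.End.one_apply]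
    · have e2 : simpleRefl n (a : ZMod n) a = a + 1 := simpleRefl_cast_self a
      have ne1 : ∀ x : ZMod n, x ≠ x + 1 := fun x h => one_ne_zero' n (by simpa using h.symm)
      by_cases h2 : (b : ZMod n) = a + 1
      -- Here s_a also moves the right end down to b - 1, so the length drops by two; b = a + 2 is
      -- excluded by congruence, and the interval stays nonempty.
      · have e3 : simpleRefl n (a : ZMod n) b = b - 1 := by
          rw [simpleRefl_apply, if_neg (Ne.symm hne), if_pos h2]
        have h3 : b ≠ a + 1 + 1 := by
          rintro rfl
          push_cast at h2
          exact ne1 _ h2.symm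
        refine IsRoot.of_simpleRefl (a : ZMod n) ?_
        rw [e2, e3]
        refine ih (d - 2) (by omega) _ _ (by omega) (by omega) ?_
        push_cast
        rw [h2, add_sub_cancel_right]
        exact (ne1 _).symm
      · refine IsRoot.of_simpleRefl (a : ZMod n) ?_
        rw [e2, simpleRefl_of_ne (Ne.symm hne) h2]
        refine ih (d - 1) (by omega) _ _ (by omega) (by omega) ?_
        push_cast
        exact Ne.symm h2

theorem isRoot_intervalRoot {a b : ℤ} (h : (a : ZMod n) ≠ b) : IsRoot n (intervalRoot n a b) := by
  rcases lt_trichotomy a b with h' | rfl | h'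
  · exact isRoot_intervalRoot_of_lt (b - a).toNat a b (Int.self_le_toNat _) h' h
  · exact absurd rfl h
  · rw [intervalRoot_swap]
    exact isRoot_neg (isRoot_intervalRoot_of_lt (a - b).toNat b a (Int.self_le_toNat _) h'
      (Ne.symm h))

theorem IsRoot.exists_intervalRoot {v : RootLattice n} (h : IsRoot n v) :
    ∃ a b : ℤ, (a : ZMod n) ≠ b ∧ v = intervalRoot n a b := by
  obtain ⟨u, i, hu, rfl⟩ := h
  obtain ⟨t, rfl⟩ := ZMod.intCast_surjective i
  refine ⟨_, _, cast_apply_ne (affineWeyl_periodic hu) (x := t) (y := t + 1) ?_,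
    rootMap_simpleRoot n u t⟩
  push_cast
  simpa using one_ne_zero' n

theorem isPosRoot_intervalRoot {a b : ℤ} (hne : (a : ZMod n) ≠ b) (h : a < b) :
    IsPosRoot n (intervalRoot n a b) :=
  ⟨isRoot_intervalRoot hne, intervalRoot_nonneg h.le⟩

theorem isNegRoot_intervalRoot {a b : ℤ} (hne : (a : ZMod n) ≠ b) (h : b < a) :
    IsNegRoot n (intervalRoot n a b) := by
  refine ⟨isRoot_intervalRoot hne, fun i => ?_⟩
  rw [intervalRoot_swap, Finsupp.neg_apply]
  have := intervalRoot_nonneg (n := n) h.le i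
  omega

theorem IsPosRoot.exists_intervalRoot {v : RootLattice n} (h : IsPosRoot n v) :
    ∃ a b : ℤ, a < b ∧ (a : ZMod n) ≠ b ∧ v = intervalRoot n a b := by
  obtain ⟨a, b, hne, rfl⟩ := h.1.exists_intervalRoot
  refine ⟨a, b, lt_of_le_of_ne (le_of_intervalRoot_nonneg h.2) ?_, hne, rfl⟩
  rintro rfl
  exact hne rfl

theorem lt_of_isNegRoot {a b : ℤ} (h : IsNegRoot n (intervalRoot n a b))
    (hne : a ≠ b) : b < a := by
  refine lt_of_le_of_ne (le_of_intervalRoot_nonneg (n := n) fun i => ?_) (Ne.symm hne)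
  rw [intervalRoot_swap, Finsupp.neg_apply]
  have := h.2 i
  omega

/-! ### Pairs of inverted roots and 321 patterns -/

theorem exists_pattern_of_roots {w : extAffineWeyl n} {a b c d : ℤ} (hab : a < b) (hcd : c < d)
    (hbc : (b : ZMod n) = c) (hba : (w : Equiv.Perm ℤ) b < (w : Equiv.Perm ℤ) a)
    (hdc : (w : Equiv.Perm ℤ) d < (w : Equiv.Perm ℤ) c) :
    ∃ a b c : ℤ, a < b ∧ b < c ∧ (w : Equiv.Perm ℤ) b < (w : Equiv.Perm ℤ) a ∧
      (w : Equiv.Perm ℤ) c < (w : Equiv.Perm ℤ) b := by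
  obtain ⟨k, rfl⟩ := exists_eq_add_mul hbc
  -- Translation by -nk makes the second inversion start at b, and periodicity keeps it an
  -- inversion.
  refine ⟨a, b, d + n * -k, hab, by linarith, hba, ?_⟩
  rw [apply_add_mul (apply_add_n n w)] at hdc ⊢
  linarith

theorem exists_roots_iff_exists_pattern (w : extAffineWeyl n) :
    (∃ α β : RootLattice n, IsPosRoot n α ∧ IsPosRoot n β ∧ IsPosRoot n (α + β) ∧
      IsNegRoot n (rootAction n w α) ∧ IsNegRoot n (rootAction n w β)) ↔
    ∃ a b c : ℤ, a < b ∧ b < c ∧ (w : Equiv.Perm ℤ) b < (w : Equiv.Perm ℤ) a ∧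
      (w : Equiv.Perm ℤ) c < (w : Equiv.Perm ℤ) b := by
  constructor
  · rintro ⟨α, β, hα, hβ, hαβ, nα, nβ⟩
    obtain ⟨a, b, hab, nab, rfl⟩ := hα.exists_intervalRoot
    obtain ⟨c, d, hcd, ncd, rfl⟩ := hβ.exists_intervalRoot
    obtain ⟨e, f, -, -, hef⟩ := hαβ.exists_intervalRoot
    rw [rootAction_intervalRoot] at nα nβ
    have hba := lt_of_isNegRoot nα fun h => hab.ne ((w : Equiv.Perm ℤ).injective h)
    have hdc := lt_of_isNegRoot nβ fun h => hcd.ne ((w : Equiv.Perm ℤ).injective h)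
    rcases chain_of_add_eq nab ncd hef with h | h
    · exact exists_pattern_of_roots hab hcd h hba hdc
    · exact exists_pattern_of_roots hcd hab h hdc hba
  · rintro ⟨a, b, c, hab, hbc, hba, hcb⟩
    have hw := apply_add_n n w
    -- Incongruence makes these intervals real roots; congruent endpoints would give a multiple of
    -- the sum of all simple roots.
    have nab := cast_ne_of_inversion hw hab hba
    have nbc := cast_ne_of_inversion hw hbc hcb
    have nac := cast_ne_of_inversion hw (hab.trans hbc) (hcb.trans hba)
    refine ⟨intervalRoot n a b, intervalRoot n b c, isPosRoot_intervalRoot nab hab,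
      isPosRoot_intervalRoot nbc hbc, ?_, ?_, ?_⟩
    · rw [intervalRoot_add]
      exact isPosRoot_intervalRoot nac (hab.trans hbc)
    · rw [rootAction_intervalRoot]
      exact isNegRoot_intervalRoot (cast_apply_ne hw nab) hba
    · rw [rootAction_intervalRoot]
      exact isNegRoot_intervalRoot (cast_apply_ne hw nbc) hcb

end AffineA

theorem proposition4p3 (n : ℕ) [hn : Fact (3 ≤ n)] (w : AffineA.extAffineWeyl n) :
    List.TFAE [
      AffineA.ExtIsFullyComm n w,
      AffineA.ExtIs321Avoiding n w,
      ¬ ∃ α β : AffineA.RootLattice n,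
        AffineA.IsPosRoot n α ∧ AffineA.IsPosRoot n β ∧ AffineA.IsPosRoot n (α + β) ∧
        AffineA.IsNegRoot n (AffineA.rootAction n w α) ∧
        AffineA.IsNegRoot n (AffineA.rootAction n w β)] := by
  tfae_have 1 ↔ 2 := by
    simp only [AffineA.ExtIsFullyComm, AffineA.ExtIs321Avoiding, AffineA.isFullyComm_iff]
  tfae_have 2 ↔ 3 := by
    rw [AffineA.exists_roots_iff_exists_pattern, AffineA.extIs321Avoiding_iff]
  tfae_finish
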